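/- Let $n_1,n_2\ge 1$ and $m\ge 2$ be integers. For a finite directed multigraph $X$ (loops and parallel edges allowed), let $\mathrm{Dist}(X,m)$ be the polytope of all families consisting of a probability vector $p_x=(p_x^a)_{a\in\mathbb{Z}_m}$ for each node $x$ and a probability matrix $p_\sigma=(p_\sigma^{a,b})_{a,b\in\mathbb{Z}_m}$ for each edge $\sigma$ such that, for every edge $\sigma$ from $x$ to $y$, $\sum_b p_\sigma^{a,b}=p_x^a$ for all $a$ and $\sum_a p_\sigma^{a,b}=p_y^b$ for all $b$. An element of $\mathrm{Dist}(X,m)$ is deterministic if all its vectors and matrices have a single nonzero entry (equal to $1$), and contextual if it is not a convex combination of deterministic elements; a contextual vertex is a vertex of the polytope $\mathrm{Dist}(X,m)$ that is contextual. A matrix $p_\sigma$ is collapsed if $p_\sigma^{a,b}=0$ whenever $a\ne b$. Let $R_n$ be the rose graph with one node and $n$ loops ($R_0$ is a single node), and let $\tilde\kappa^{(1)}(n,m)$ be the number of contextual vertices $p$ of $\mathrm{Dist}(R_n,m)$ such that $p_\sigma$ is not collapsed for any loop $\sigma$. Let $K_{n_1,n_2}$ be the complete bipartite graph with parts of sizes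 $n_1$ and $n_2$, every edge directed from the first part to the second. Then $\mathrm{Dist}(K_{n_1,n_2},m)$ has at least $$\tilde\kappa^{(1)}\bigl((n_1-1)(n_2-1),\,m\bigr)\cdot n_1^{\,n_2-1}\,n_2^{\,n_1-1}$$ contextual vertices. -/

import Mathlib

/-- A directed multigraph with node type `V` and edge type `E`; loops and parallel edges are
allowed. (`src` is the face map `d₁`, `tgt` is the face map `d₀`.) -/
structure DiMultigraph (V E : Type*) where
  src : E → V
  tgt : E → V

namespace DiMultigraph

/-- The complete bipartite graph, every edge directed from the first part to the second. -/
def completeBipartite (n₁ n₂ : ℕ) : DiMultigraph (Fin n₁ ⊕ Fin n₂) (Fin n₁ × Fin n₂) where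
  src e := Sum.inl e.1
  tgt e := Sum.inr e.2

/-- The rose graph: one node and `n` loops (for `n = 0` a single node without loops). -/
def rose (n : ℕ) : DiMultigraph Unit (Fin n) where
  src _ := ()
  tgt _ := ()

variable {V E : Type*}

/-- The polytope of graph distributions on `X` with `m` outcomes: a probability vector `p.1 x` at
every node and a probability matrix `p.2 e` on every edge, whose row sums give the vector at the
source and whose column sums give the vector at the target. -/
def distPolytope (X : DiMultigraph V E) (m : ℕ) :
    Set ((V → Fin m → ℝ) × (E → Fin m × Fin m → ℝ)) :=
  {p | (∀ x, p.1 x ∈ stdSimplex ℝ (Fin m)) ∧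
       (∀ e, p.2 e ∈ stdSimplex ℝ (Fin m × Fin m)) ∧
       (∀ e a, p.1 (X.src e) a = ∑ b, p.2 e (a, b)) ∧
       (∀ e b, p.1 (X.tgt e) b = ∑ a, p.2 e (a, b))}

/-- The deterministic distributions: all probability vectors and matrices are point masses. -/
def deterministic (X : DiMultigraph V E) (m : ℕ) :
    Set ((V → Fin m → ℝ) × (E → Fin m × Fin m → ℝ)) :=
  {p | p ∈ X.distPolytope m ∧
       (∀ x, ∃ a, p.1 x = Pi.single a 1) ∧ (∀ e, ∃ ab, p.2 e = Pi.single ab 1)}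

/-- The contextual vertices: the vertices of the polytope of distributions that are not convex
combinations of deterministic distributions. -/
def contextualVertices (X : DiMultigraph V E) (m : ℕ) :
    Set ((V → Fin m → ℝ) × (E → Fin m × Fin m → ℝ)) :=
  {p | p ∈ (X.distPolytope m).extremePoints ℝ ∧ p ∉ convexHull ℝ (X.deterministic m)}

end DiMultigraph

/-- A distribution on pairs of outcomes is collapsed if it vanishes off the diagonal. -/
def IsCollapsed {m : ℕ} (Q : Fin m × Fin m → ℝ) : Prop :=
  ∀ a b, a ≠ b → Q (a, b) = 0

/-- The number of contextual vertices on the rose graph with `n` loops and `m` outcomes that are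
not collapsed on any loop. -/
noncomputable def kappaTilde (n m : ℕ) : ℕ∞ :=
  {p | p ∈ (DiMultigraph.rose n).contextualVertices m ∧ ∀ i, ¬ IsCollapsed (p.2 i)}.encard

/-! Spanning trees of the bipartite graph index disjoint families of contextual vertices.
Contracting a spanning tree `S` leaves a rose whose loops are the (n₁-1)(n₂-1) edges outside `S`. A
distribution on this rose pulls back through `expand`, with collapsed matrices on `S`. The pullbacks
form a face of the polytope, cut out by vanishing off-diagonal entries on `S`, so vertices go to
vertices (`expand_mem_extremePoints`) and contextuality survives. If no loop is collapsed, `S` is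
recovered as the set of collapsed edges, so different trees give different vertices
(`kappaTilde_mul_card_isSpanning_le`).

It remains to bound the number of trees below by n₁^(n₂-1) n₂^(n₁-1). Only one half of the
matrix-tree theorem is needed: in the Cauchy–Binet expansion of the reduced Laplacian determinant,
each edge set contributes at most 1, and a nonzero contribution forces it to be spanning
(`det_le_card_isSpanning`). -/

/-! ### Cauchy–Binet expansion of Gram determinants -/

open Matrix Finset in
theorem Matrix.det_mul_transpose_eq_sum {ι E R : Type*} [Fintype ι] [DecidableEq ι] [Fintype E]
    [DecidableEq E] [CommRing R] (M N : Matrix ι E R) :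
    (M * Nᵀ).det = ∑ f : ι → E, (∏ i, M i (f i)) * (N.submatrix id f).det := by
  have h : M * Nᵀ = fun i => ∑ e, M i e • fun j => N j e := by
    ext i j
    simp [Matrix.mul_apply]
  have h2 := (Matrix.detRowAlternating (n := ι) (R := R)).toMultilinearMap.map_sum
    (fun i e => M i e • fun j => N j e)
  rw [h]
  refine h2.trans (Finset.sum_congr rfl fun f _ => ?_)
  rw [MultilinearMap.map_smul_univ, smul_eq_mul, ← Matrix.det_transpose (N.submatrix id f)]
  rfl

open Matrix Finset in
/-- A bound of Cauchy–Binet type: if all maximal minors of `M` have square at most one, then the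
Gram determinant of `M` is at most the number of column sets with a nonzero maximal minor. -/
theorem Matrix.det_mul_transpose_le_card {ι E : Type*} [Fintype ι] [DecidableEq ι] [Fintype E]
    [DecidableEq E] (M : Matrix ι E ℝ) (hM : ∀ f : ι → E, (M.submatrix id f).det ^ 2 ≤ 1)
    (T : Finset (Finset E))
    (hT : ∀ f : ι → E, Function.Injective f → (M.submatrix id f).det ≠ 0 → univ.image f ∈ T) :
    (M * Mᵀ).det ≤ #T := by
  rw [Matrix.det_mul_transpose_eq_sum, ← Finset.sum_fiberwise univ (fun f : ι → E => univ.image f)]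
  have key : ∀ S : Finset E, ∑ f : ι → E with univ.image f = S,
      (∏ i, M i (f i)) * (M.submatrix id f).det ≤ if S ∈ T then 1 else 0 := by
    intro S
    have hinj : ∀ f : ι → E, (M.submatrix id f).det ≠ 0 → Function.Injective f := by
      intro f hf i j hij
      by_contra hne
      exact hf (Matrix.det_zero_of_column_eq hne fun k => by simp [hij])
    by_cases hS : ∃ g : ι → E, univ.image g = S ∧ (M.submatrix id g).det ≠ 0
    · obtain ⟨g, hgS, hg⟩ := hS
      have hgi := hinj g hg
      rw [if_pos (hgS ▸ hT g hgi hg)]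
      -- The nonzero terms with image `S` come from the reorderings of `g`; together they add up to
      -- the squared minor.
      have hsum : ∑ σ : Equiv.Perm ι, (∏ i, M i (g (σ i))) * (M.submatrix id (g ∘ σ)).det =
          ∑ f : ι → E with univ.image f = S, (∏ i, M i (f i)) * (M.submatrix id f).det := by
        refine Finset.sum_of_injOn (fun σ : Equiv.Perm ι => g ∘ σ) ?_ ?_ ?_ ?_
        · intro σ _ τ _ h
          ext i
          exact hgi (congrFun h i)
        · intro σ _
          simp only [coe_filter, mem_univ, true_and, Set.mem_ofPred_eq]
          rw [← hgS]
          ext e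
          simp only [mem_image, mem_univ, true_and, Function.comp_apply]
          exact (σ.surjective.exists (p := fun i => g i = e)).symm
        · intro f hf hf'
          by_contra hne
          have hfi := hinj f (right_ne_zero_of_mul hne)
          have hfS : univ.image f = univ.image g := by
            rw [hgS]; simpa using hf
          have hex : ∀ i, ∃ j, g j = f i := fun i => by
            have : f i ∈ univ.image g := hfS ▸ mem_image_of_mem f (mem_univ i)
            simpa using this
          choose τ hτ using hex
          have hτi : Function.Injective τ := fun i j h => hfi (by rw [← hτ, ← hτ, h])
          refine hf' ⟨Equiv.ofBijective τ (Finite.injective_iff_bijective.mp hτi), by simp, ?_⟩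
          ext i
          exact hτ i
        · intro σ _
          rfl
      have hdet : ∑ σ : Equiv.Perm ι, (∏ i, M i (g (σ i))) * (M.submatrix id (g ∘ σ)).det =
          (M.submatrix id g).det ^ 2 := by
        have hperm : ∀ σ : Equiv.Perm ι, (M.submatrix id (g ∘ σ)).det =
            Equiv.Perm.sign σ * (M.submatrix id g).det := fun σ => by
          rw [← Matrix.det_permute' σ (M.submatrix id g), Matrix.submatrix_submatrix]
          rfl
        rw [sq, ← Matrix.det_transpose (M.submatrix id g)]
        nth_rewrite 1 [Matrix.det_apply']
        rw [Finset.sum_mul]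
        refine Finset.sum_congr rfl fun σ _ => ?_
        rw [hperm, Matrix.det_transpose]
        simp only [Matrix.transpose_apply, Matrix.submatrix_apply, id]
        ring
      rw [← hsum, hdet]
      exact hM g
    · push Not at hS
      rw [Finset.sum_eq_zero fun f hf => by rw [hS f (by simpa using hf), mul_zero]]
      split_ifs <;> norm_num
  refine (Finset.sum_le_sum fun S _ => key S).trans ?_
  simp

/-! ### Counting spanning trees -/

namespace DiMultigraph

variable {V E W : Type*}

/-- The incidence matrix of a directed multigraph with rows restricted along `ι : W → V`. -/
def incidence [DecidableEq V] (X : DiMultigraph V E) (ι : W → V) : Matrix W E ℝ :=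
  Matrix.of fun w e => (if X.src e = ι w then 1 else 0) - (if X.tgt e = ι w then 1 else 0)

/-- Total unimodularity, by induction on size. If all columns sum to zero, the rows are dependent.
Otherwise some edge has exactly one endpoint among the chosen nodes, and its column has a single
entry ±1 along which to expand. -/
theorem incidence_det_sq_le_one_fin [DecidableEq V] (r : ℕ) (X : DiMultigraph V (Fin r))
    (ι : Fin r → V) (hι : Function.Injective ι) : (X.incidence ι).det ^ 2 ≤ 1 := by
  induction r with
  | zero => simp
  | succ r ih =>
    by_cases h0 : ∀ j, ∑ i, X.incidence ι i j = 0
    · have : (X.incidence ι).det = 0 := by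
        refine Matrix.exists_vecMul_eq_zero_iff.mp ⟨fun _ => 1, ?_, ?_⟩
        · intro h
          exact one_ne_zero (congrFun h 0)
        · ext j
          simpa [Matrix.vecMul, dotProduct] using h0 j
      simp [this]
    · push Not at h0
      obtain ⟨j, hj⟩ := h0
      have hcol : ∃ i₀, (X.incidence ι i₀ j) ^ 2 = 1 ∧ ∀ i, i ≠ i₀ → X.incidence ι i j = 0 := by
        by_cases hs : ∃ i, X.src j = ι i <;> by_cases ht : ∃ i, X.tgt j = ι i
        · obtain ⟨i, hi⟩ := hs
          obtain ⟨k, hk⟩ := ht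
          exact absurd (by simp [incidence, hi, hk, hι.eq_iff]) hj
        · obtain ⟨i, hi⟩ := hs
          push Not at ht
          refine ⟨i, by simp [incidence, hi, ht], fun k hk => ?_⟩
          simp [incidence, hi, ht, hι.eq_iff, hk.symm]
        · obtain ⟨i, hi⟩ := ht
          push Not at hs
          refine ⟨i, by simp [incidence, hi, hs], fun k hk => ?_⟩
          simp [incidence, hi, hs, hι.eq_iff, hk.symm]
        · push Not at hs ht
          exact absurd (by simp [incidence, hs, ht]) hj
      obtain ⟨i₀, h1, h2⟩ := hcol
      rw [Matrix.det_succ_column _ j, Finset.sum_eq_single i₀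
        (fun i _ hi => by rw [h2 i hi]; ring) (by simp)]
      have := ih ⟨X.src ∘ j.succAbove, X.tgt ∘ j.succAbove⟩ (ι ∘ i₀.succAbove)
        (hι.comp Fin.succAbove_right_injective)
      rw [mul_pow, mul_pow, h1, ← pow_mul, mul_comm _ 2, pow_mul]
      simp only [even_two, Even.neg_pow, one_pow, one_mul]
      exact this

theorem incidence_det_sq_le_one [DecidableEq V] [Fintype W] [DecidableEq W]
    (X : DiMultigraph V E) (ι : W → V) (hι : Function.Injective ι) (f : W → E) :
    ((X.incidence ι).submatrix id f).det ^ 2 ≤ 1 := by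
  let e := (Fintype.equivFin W).symm
  rw [← Matrix.det_submatrix_equiv_self e]
  exact incidence_det_sq_le_one_fin _ ⟨X.src ∘ f ∘ e, X.tgt ∘ f ∘ e⟩ (ι ∘ e) (hι.comp e.injective)

/-- A set of edges is spanning if it connects all nodes, expressed through real potentials: a
function on nodes that agrees at both ends of every edge of the set is constant. -/
def IsSpanning (X : DiMultigraph V E) (S : Finset E) : Prop :=
  ∀ φ : V → ℝ, (∀ e ∈ S, φ (X.src e) = φ (X.tgt e)) → ∀ x y, φ x = φ y

-- A potential that agrees along the chosen edges, shifted to vanish at the root `r`, lies in the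
-- left kernel of the minor, hence is zero.
open Finset in
theorem isSpanning_of_det_ne_zero [DecidableEq V] [DecidableEq E] [Fintype W] [DecidableEq W]
    (X : DiMultigraph V E) (ι : W → V) (hι : Function.Injective ι) (r : V)
    (hr : ∀ v, v = r ∨ ∃ w, ι w = v) (f : W → E)
    (hf : ((X.incidence ι).submatrix id f).det ≠ 0) : X.IsSpanning (univ.image f) := by
  intro φ hφ
  have hker : (fun w => φ (ι w) - φ r) = 0 := by
    refine Matrix.eq_zero_of_vecMul_eq_zero hf ?_
    have hsum : ∀ v, ∑ w, (if v = ι w then φ (ι w) - φ r else 0) = φ v - φ r := by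
      intro v
      rcases hr v with rfl | ⟨w, rfl⟩
      · refine (Finset.sum_eq_zero fun w _ => ?_).trans (sub_self _).symm
        split_ifs with h
        · rw [← h, sub_self]
        · rfl
      · simp [hι.eq_iff]
    ext j
    have := hφ (f j) (mem_image_of_mem f (mem_univ j))
    simp only [Matrix.vecMul, dotProduct, Matrix.submatrix_apply, id, incidence, Matrix.of_apply,
      mul_sub, mul_ite, mul_one, mul_zero, Finset.sum_sub_distrib, hsum, Pi.zero_apply]
    rw [this, sub_self]
  have hconst : ∀ v, φ v = φ r := fun v => by
    rcases hr v with rfl | ⟨w, rfl⟩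
    · rfl
    · exact sub_eq_zero.mp (congrFun hker w)
  intro x y
  rw [hconst x, hconst y]

open Finset Classical in
/-- The lower bound in the matrix-tree theorem. -/
theorem det_le_card_isSpanning [Fintype E] [DecidableEq V] [Fintype W] [DecidableEq W]
    (X : DiMultigraph V E) (ι : W → V) (hι : Function.Injective ι) (r : V)
    (hr : ∀ v, v = r ∨ ∃ w, ι w = v) :
    (X.incidence ι * (X.incidence ι).transpose).det ≤
      #{S : Finset E | X.IsSpanning S ∧ #S = Fintype.card W} := by
  refine Matrix.det_mul_transpose_le_card _ (X.incidence_det_sq_le_one ι hι) _ fun f hf hdet => ?_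
  simp only [mem_filter, mem_univ, true_and]
  exact ⟨X.isSpanning_of_det_ne_zero ι hι r hr f hdet, card_image_of_injective _ hf⟩

open Matrix in
theorem laplacian_completeBipartite (n k : ℕ) :
    (completeBipartite n (k + 1)).incidence (Sum.map id Fin.succ) *
      ((completeBipartite n (k + 1)).incidence (Sum.map id Fin.succ))ᵀ =
      Matrix.fromBlocks (((k : ℝ) + 1) • (1 : Matrix (Fin n) (Fin n) ℝ))
        (Matrix.of fun _ _ => -1) (Matrix.of fun _ _ => -1)
        ((n : ℝ) • (1 : Matrix (Fin k) (Fin k) ℝ)) := by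
  ext (a | i) (b | j)
  · rcases eq_or_ne a b with rfl | h
    · simp [Matrix.mul_apply, incidence, completeBipartite, Fintype.sum_prod_type]
    · simp [Matrix.mul_apply, incidence, completeBipartite, Fintype.sum_prod_type, h, h.symm]
  · simp [Matrix.mul_apply, incidence, completeBipartite, Fintype.sum_prod_type]
  · simp [Matrix.mul_apply, incidence, completeBipartite, Fintype.sum_prod_type]
  · rcases eq_or_ne i j with rfl | h
    · simp [Matrix.mul_apply, incidence, completeBipartite, Fintype.sum_prod_type]
    · simp [Matrix.mul_apply, incidence, completeBipartite, Fintype.sum_prod_type, h, h.symm]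

open Matrix in
theorem det_laplacian_completeBipartite (n k : ℕ) (hn : 1 ≤ n) :
    ((completeBipartite n (k + 1)).incidence (Sum.map id Fin.succ) *
      ((completeBipartite n (k + 1)).incidence (Sum.map id Fin.succ))ᵀ).det =
      (n : ℝ) ^ k * ((k : ℝ) + 1) ^ (n - 1) := by
  have hk : (k : ℝ) + 1 ≠ 0 := by positivity
  have hn' : (n : ℝ) ≠ 0 := by positivity
  rw [laplacian_completeBipartite]
  -- The Schur complement of this scalar block is a rank-one perturbation of a scalar matrix.
  let _ : Invertible (((k : ℝ) + 1) • (1 : Matrix (Fin n) (Fin n) ℝ)) :=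
    ⟨((k : ℝ) + 1)⁻¹ • 1, by simp [smul_smul, hk], by simp [smul_smul, hk]⟩
  rw [Matrix.det_fromBlocks₁₁]
  have hinv : ⅟(((k : ℝ) + 1) • (1 : Matrix (Fin n) (Fin n) ℝ)) = ((k : ℝ) + 1)⁻¹ • 1 := rfl
  have hschur : (n : ℝ) • (1 : Matrix (Fin k) (Fin k) ℝ) -
      (Matrix.of fun _ _ => -1 : Matrix (Fin k) (Fin n) ℝ) *
        ⅟(((k : ℝ) + 1) • (1 : Matrix (Fin n) (Fin n) ℝ)) *
        (Matrix.of fun _ _ => -1 : Matrix (Fin n) (Fin k) ℝ) =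
      (n : ℝ) • (1 + Matrix.replicateCol Unit (fun _ : Fin k => -((k : ℝ) + 1)⁻¹) *
        Matrix.replicateRow Unit (fun _ : Fin k => (1 : ℝ))) := by
    rw [hinv]
    ext i j
    simp [Matrix.mul_apply]
    ring
  rw [hschur, Matrix.det_smul, Matrix.det_smul, Matrix.det_one_add_replicateCol_mul_replicateRow]
  obtain ⟨n, rfl⟩ : ∃ l, n = l + 1 := ⟨n - 1, by omega⟩
  simp [dotProduct, pow_succ]
  field_simp
  ring

open Finset Classical in
theorem le_card_isSpanning_completeBipartite (n k : ℕ) (hn : 1 ≤ n) :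
    n ^ k * (k + 1) ^ (n - 1) ≤
      #{S : Finset (Fin n × Fin (k + 1)) |
        (completeBipartite n (k + 1)).IsSpanning S ∧ #S = n + k} := by
  have h := (completeBipartite n (k + 1)).det_le_card_isSpanning (Sum.map id Fin.succ)
    (Sum.map_injective.mpr ⟨Function.injective_id, Fin.succ_injective k⟩) (Sum.inr 0) (by
      rintro (a | b)
      · exact Or.inr ⟨Sum.inl a, rfl⟩
      · refine Fin.cases (Or.inl rfl) (fun j => Or.inr ⟨Sum.inr j, rfl⟩) b)
  rw [det_laplacian_completeBipartite n k hn] at h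
  simp only [Fintype.card_sum, Fintype.card_fin] at h
  exact_mod_cast h

end DiMultigraph

/-! ### Lifting vertices from the rose -/

namespace DiMultigraph

variable {V E : Type*} {n m : ℕ}

/-- The collapsed distribution on pairs of outcomes with given marginal. -/
def diagDist (q : Fin m → ℝ) : Fin m × Fin m → ℝ :=
  fun ab => if ab.1 = ab.2 then q ab.1 else 0

theorem isCollapsed_diagDist (q : Fin m → ℝ) : IsCollapsed (diagDist q) :=
  fun _ _ h => if_neg h

theorem eq_diagDist_of_isCollapsed {Q : Fin m × Fin m → ℝ} (hQ : IsCollapsed Q) {q : Fin m → ℝ}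
    (hq : ∀ a, q a = ∑ b, Q (a, b)) : Q = diagDist q := by
  ext ⟨a, b⟩
  by_cases h : a = b
  · subst h
    rw [diagDist, if_pos rfl, hq, Finset.sum_eq_single a (fun b _ hb => hQ a b hb.symm) (by simp)]
  · rw [hQ a b h, isCollapsed_diagDist q a b h]

/-- The distribution on a graph that restricts to the distribution `p` on the rose obtained by
contracting the edges in `S`, the remaining edges being numbered by `η`. -/
noncomputable def expand [DecidableEq E] (S : Finset E) (η : {e // e ∉ S} ≃ Fin n)
    (p : (Unit → Fin m → ℝ) × (Fin n → Fin m × Fin m → ℝ)) :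
    (V → Fin m → ℝ) × (E → Fin m × Fin m → ℝ) :=
  (fun _ => p.1 (), fun e => if h : e ∈ S then diagDist (p.1 ()) else p.2 (η ⟨e, h⟩))

/-- The restriction of a distribution to a node `x` and the edges outside `S`, as a linear map. -/
def contract (S : Finset E) (η : {e // e ∉ S} ≃ Fin n) (x : V) :
    ((V → Fin m → ℝ) × (E → Fin m × Fin m → ℝ)) →ₗ[ℝ]
      (Unit → Fin m → ℝ) × (Fin n → Fin m × Fin m → ℝ) where
  toFun q := (fun _ => q.1 x, fun i => q.2 (η.symm i))
  map_add' _ _ := rfl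
  map_smul' _ _ := rfl

theorem convex_distPolytope (X : DiMultigraph V E) (m : ℕ) : Convex ℝ (X.distPolytope m) := by
  rintro p ⟨h1, h2, h3, h4⟩ q ⟨k1, k2, k3, k4⟩ α β hα hβ hαβ
  refine ⟨fun x => convex_stdSimplex ℝ _ (h1 x) (k1 x) hα hβ hαβ,
    fun e => convex_stdSimplex ℝ _ (h2 e) (k2 e) hα hβ hαβ, fun e a => ?_, fun e b => ?_⟩
  · simp [h3, k3, Finset.sum_add_distrib, Finset.mul_sum]
  · simp [h4, k4, Finset.sum_add_distrib, Finset.mul_sum]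

section

variable [DecidableEq E] {S : Finset E} {η : {e // e ∉ S} ≃ Fin n}

theorem contract_expand (x : V) (p : (Unit → Fin m → ℝ) × (Fin n → Fin m × Fin m → ℝ)) :
    contract S η x (expand S η p) = p := by
  refine Prod.ext rfl (funext fun i => ?_)
  simp [contract, expand, (η.symm i).2]

theorem expand_mem_distPolytope (X : DiMultigraph V E)
    {p : (Unit → Fin m → ℝ) × (Fin n → Fin m × Fin m → ℝ)} (hp : p ∈ (rose n).distPolytope m) :
    expand S η p ∈ X.distPolytope m := by
  obtain ⟨h1, h2, h3, h4⟩ := hp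
  refine ⟨fun _ => h1 (), fun e => ?_, fun e a => ?_, fun e b => ?_⟩
  · by_cases h : e ∈ S
    · simp only [expand, h, dif_pos]
      refine ⟨fun ab => ?_, ?_⟩
      · unfold diagDist
        split_ifs
        exacts [(h1 ()).1 _, le_rfl]
      · rw [Fintype.sum_prod_type]
        simpa [diagDist] using (h1 ()).2
    · simpa only [expand, h, dif_neg, not_false_eq_true] using h2 _
  · by_cases h : e ∈ S
    · simp [expand, h, diagDist]
    · simpa only [expand, h, dif_neg, not_false_eq_true] using h3 (η ⟨e, h⟩) a
  · by_cases h : e ∈ S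
    · simp [expand, h, diagDist]
    · simpa only [expand, h, dif_neg, not_false_eq_true] using h4 (η ⟨e, h⟩) b

/-- A collapsed edge has equal marginals at its two ends, so for each outcome the node probabilities
are a potential constant along `S`, and spanning makes them globally constant. -/
theorem expand_contract {X : DiMultigraph V E} (hS : X.IsSpanning S) (x : V)
    {q : (V → Fin m → ℝ) × (E → Fin m × Fin m → ℝ)} (hq : q ∈ X.distPolytope m)
    (hc : ∀ e ∈ S, IsCollapsed (q.2 e)) :
    contract S η x q ∈ (rose n).distPolytope m ∧ expand S η (contract S η x q) = q := by
  obtain ⟨h1, h2, h3, h4⟩ := hq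
  have hconst : ∀ y, q.1 y = q.1 x := by
    intro y
    ext a
    refine hS (fun v => q.1 v a) (fun e he => ?_) y x
    simp only [h3 e a, h4 e a]
    rw [Finset.sum_eq_single a (fun b _ hb => hc e he a b hb.symm) (by simp),
      Finset.sum_eq_single a (fun b _ hb => hc e he b a hb) (by simp)]
  refine ⟨⟨fun _ => h1 x, fun i => h2 _, fun i a => ?_, fun i b => ?_⟩, ?_⟩
  · exact (congrFun (hconst _) a).symm.trans (h3 (η.symm i) a)
  · exact (congrFun (hconst _) b).symm.trans (h4 (η.symm i) b)
  · refine Prod.ext (funext fun y => (hconst y).symm) (funext fun e => ?_)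
    by_cases h : e ∈ S
    · simp only [expand, h, dif_pos, contract, LinearMap.coe_mk, AddHom.coe_mk]
      refine (eq_diagDist_of_isCollapsed (hc e h) fun a => ?_).symm
      rw [← h3, hconst (X.src e)]
    · simp [expand, h, contract]

/-- Nonnegativity forces both parts of a convex decomposition to vanish wherever the lift does, so
both are collapsed on `S` and the decomposition descends to the rose. -/
theorem expand_mem_extremePoints {X : DiMultigraph V E} (hS : X.IsSpanning S) (x : V)
    {p : (Unit → Fin m → ℝ) × (Fin n → Fin m × Fin m → ℝ)}
    (hp : p ∈ ((rose n).distPolytope m).extremePoints ℝ) :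
    expand S η p ∈ (X.distPolytope m).extremePoints ℝ := by
  rw [mem_extremePoints_iff_left] at hp ⊢
  refine ⟨expand_mem_distPolytope X hp.1, fun q hq r hr hqr => ?_⟩
  obtain ⟨α, β, hα, hβ, hαβ, hsum⟩ := hqr
  have hzero : ∀ e ∈ S, ∀ a b, a ≠ b → q.2 e (a, b) = 0 ∧ r.2 e (a, b) = 0 := by
    intro e he a b hab
    have h0 : α * q.2 e (a, b) + β * r.2 e (a, b) = 0 := by
      have := congrFun (congrFun (congrArg Prod.snd hsum) e) (a, b)
      simpa [expand, he, diagDist, hab] using this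
    have hq0 := (hq.2.1 e).1 (a, b)
    have hr0 := (hr.2.1 e).1 (a, b)
    have h1 := mul_nonneg hα.le hq0
    have h2 := mul_nonneg hβ.le hr0
    constructor
    · exact (mul_eq_zero.mp (by linarith)).resolve_left hα.ne'
    · exact (mul_eq_zero.mp (by linarith)).resolve_left hβ.ne'
  obtain ⟨hq', hqe⟩ := expand_contract (η := η) hS x hq fun e he a b h => (hzero e he a b h).1
  obtain ⟨hr', -⟩ := expand_contract (η := η) hS x hr fun e he a b h => (hzero e he a b h).2
  have := hp.2 _ hq' _ hr' ⟨α, β, hα, hβ, hαβ, by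
    rw [← map_smul, ← map_smul, ← map_add, hsum, contract_expand]⟩
  rw [← hqe, this]

/-- A vertex in the hull of the deterministic points is itself deterministic, and restriction
preserves this. -/
theorem expand_mem_contextualVertices {X : DiMultigraph V E} (hS : X.IsSpanning S) (x : V)
    {p : (Unit → Fin m → ℝ) × (Fin n → Fin m × Fin m → ℝ)}
    (hp : p ∈ (rose n).contextualVertices m) : expand S η p ∈ X.contextualVertices m := by
  have hext := expand_mem_extremePoints (η := η) hS x hp.1
  refine ⟨hext, fun hmem => hp.2 (subset_convexHull ℝ _ ⟨hp.1.1, ?_⟩)⟩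
  have hsub : convexHull ℝ (X.deterministic m) ⊆ X.distPolytope m := 
    convexHull_min (fun q hq => hq.1) (X.convex_distPolytope m)
  have hdet : expand S η p ∈ X.deterministic m := extremePoints_convexHull_subset
    (inter_extremePoints_subset_extremePoints_of_subset hsub ⟨hmem, hext⟩)
  have hp' := contract_expand (S := S) (η := η) x p
  rw [← hp']
  exact ⟨fun _ => hdet.2.1 x, fun i => hdet.2.2 _⟩

theorem isCollapsed_expand_iff {p : (Unit → Fin m → ℝ) × (Fin n → Fin m × Fin m → ℝ)}
    (hp : ∀ i, ¬ IsCollapsed (p.2 i)) (e : E) :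
    IsCollapsed ((expand (V := V) S η p).2 e) ↔ e ∈ S := by
  by_cases h : e ∈ S
  · simp only [expand, h, dif_pos, isCollapsed_diagDist]
  · simp only [expand, h, dif_neg, not_false_eq_true, hp]

end

open Finset Classical in
theorem kappaTilde_mul_card_isSpanning_le [Fintype E] [Nonempty V] (X : DiMultigraph V E)
    (n m : ℕ) :
    kappaTilde n m * (#{S : Finset E | X.IsSpanning S ∧ #S + n = Fintype.card E} : ℕ∞) ≤
      (X.contextualVertices m).encard := by
  obtain ⟨x⟩ := ‹Nonempty V›
  have hη : ∀ S : Finset E, #S + n = Fintype.card E → Nonempty ({e // e ∉ S} ≃ Fin n) := by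
    intro S hS
    refine ⟨Fintype.equivFinOfCardEq ?_⟩
    rw [Fintype.card_subtype_compl, Fintype.card_coe]
    omega
  let η := fun S hS => (hη S hS).some
  rw [kappaTilde, ← Set.encard_coe_eq_coe_finsetCard, ← Set.encard_prod]
  let F : ((Unit → Fin m → ℝ) × (Fin n → Fin m × Fin m → ℝ)) × Finset E →
      (V → Fin m → ℝ) × (E → Fin m × Fin m → ℝ) := fun z =>
    -- The value 0 is never used: every edge set counted satisfies `h`.
    if h : #z.2 + n = Fintype.card E then expand z.2 (η z.2 h) z.1 else 0
  refine Set.encard_le_encard_of_injOn (f := F) ?_ ?_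
  · rintro ⟨p, S⟩ ⟨hp, hS⟩
    simp only [coe_filter, mem_univ, true_and, Set.mem_ofPred_eq] at hS
    simp only [F, dif_pos hS.2]
    exact expand_mem_contextualVertices hS.1 x hp.1
  · rintro ⟨p, S⟩ ⟨hp, hS⟩ ⟨q, T⟩ ⟨hq, hT⟩ h
    simp only [coe_filter, mem_univ, true_and, Set.mem_ofPred_eq] at hS hT
    simp only [F, dif_pos hS.2, dif_pos hT.2] at h
    obtain rfl : S = T := by
      ext e
      rw [← isCollapsed_expand_iff (V := V) (η := η S hS.2) hp.2 e, h,
        isCollapsed_expand_iff hq.2 e]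
    refine Prod.ext ?_ rfl
    have := congrArg (contract S (η S hS.2) x) h
    simpa only [contract_expand] using this

end DiMultigraph

theorem corollary6p5 (n₁ n₂ m : ℕ) (hn₁ : 1 ≤ n₁) (hn₂ : 1 ≤ n₂) (hm : 2 ≤ m) :
    kappaTilde ((n₁ - 1) * (n₂ - 1)) m * ((n₁ ^ (n₂ - 1) * n₂ ^ (n₁ - 1) : ℕ) : ℕ∞) ≤
      ((DiMultigraph.completeBipartite n₁ n₂).contextualVertices m).encard := by
  classical
  obtain ⟨k, rfl⟩ : ∃ k, n₂ = k + 1 := ⟨n₂ - 1, by omega⟩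
  obtain ⟨l, rfl⟩ : ∃ l, n₁ = l + 1 := ⟨n₁ - 1, by omega⟩
  have hcard := DiMultigraph.le_card_isSpanning_completeBipartite (l + 1) k hn₁
  refine le_trans ?_ (DiMultigraph.kappaTilde_mul_card_isSpanning_le _
    ((l + 1 - 1) * (k + 1 - 1)) m)
  refine mul_le_mul_right (Nat.cast_le.mpr (hcard.trans (Finset.card_le_card ?_))) _
  intro S hS
  simp only [Finset.mem_filter, Finset.mem_univ, true_and] at hS ⊢
  refine ⟨hS.1, ?_⟩
  -- Tree edges plus loops exhaust the edges: (l+1+k) + lk = (l+1)(k+1).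
  simp only [hS.2, Fintype.card_prod, Fintype.card_fin, Nat.add_sub_cancel]
  ring
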